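/- Let $G$ be a finite simple graph on $n\ge 1$ vertices that is $r$-regular with $r\ge 1$ ($G$ need not be connected). Let $\mathcal T(G)$ be the total graph of $G$: its vertices are the vertices and the edges of $G$, and two of them are adjacent if and only if they are adjacent vertices of $G$, distinct edges of $G$ with a common end vertex, or a vertex of $G$ and an edge of $G$ incident to it. For a finite graph $H$ let $IE(H)$ denote its incidence energy, i.e. the sum of the singular values of the vertex-edge incidence matrix of $H$ (whose $(v,e)$ entry is $1$ if $v$ is an end of $e$ and $0$ otherwise). Then $$IE(\mathcal T(G))<\frac{n(r-2)\sqrt{2r-2}}{2}+2n\sqrt r+(n-1)\sqrt{3r-2}$$ and $$IE(\mathcal T(G))\ \ge\ \frac{n(r-2)\sqrt{2r-2}}{2}+(n+1)\sqrt r+\sqrt{3r-2}+(n-1)\sqrt{2r-2},$$ and equality holds in the second inequality if and only if $G\cong K_2$. -/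

import Mathlib

namespace SimpleGraph

variable {V : Type*}

/-- Adjacency in the total graph: two elements (vertices or edges) of `G` are adjacent when they
are adjacent vertices, distinct edges with a common end, or a vertex and an edge incident to it. -/
def totalAdj (G : SimpleGraph V) : V ⊕ G.edgeSet → V ⊕ G.edgeSet → Prop
  | .inl u, .inl v => G.Adj u v
  | .inl u, .inr e => u ∈ (e : Sym2 V)
  | .inr e, .inl u => u ∈ (e : Sym2 V)
  | .inr e, .inr f => G.lineGraph.Adj e f

/-- The total graph of `G`, on the disjoint union of the vertices and the edges of `G`. -/
def totalGraph (G : SimpleGraph V) : SimpleGraph (V ⊕ G.edgeSet) where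
  Adj := G.totalAdj
  symm := ⟨by
    rintro (u | e) (v | f) h
    · exact G.adj_symm h
    · exact h
    · exact h
    · exact G.lineGraph.adj_symm h⟩
  loopless := ⟨by
    rintro (u | e) h
    · exact G.irrefl h
    · exact G.lineGraph.irrefl h⟩

open Classical in
/-- The vertex-edge incidence matrix of `G`, with one column for each edge of `G`. -/
noncomputable def edgeIncMatrix (G : SimpleGraph V) : Matrix V G.edgeSet ℝ :=
  (G.incMatrix ℝ).submatrix id Subtype.val

open Classical in
/-- The incidence energy of a finite graph: the sum of the singular values of its incidence
matrix. -/
noncomputable def incidenceEnergy [Fintype V] (G : SimpleGraph V) : ℝ :=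
  (Matrix.toEuclideanLin G.edgeIncMatrix).singularValues.sum fun _ s => s

end SimpleGraph

/-! Since B Bᵀ = D + A, incidence energy is the sum of square roots of the signless Laplacian
eigenvalues. For r-regular G with m edges, block elimination gives those of the total graph: 2r-2
with net multiplicity m-n = n(r-2)/2, and for each adjacency eigenvalue t the two roots of a
quadratic (`charpoly_totalGraph`). So the energy is the 2r-2 term plus ∑ f(t), f being the sum of
the square roots of the two roots.

Lower bound: t = r occurs and f(r) is explicit; elsewhere t ≥ -r gives f(t) ≥ f(-r), strictly if t >
-r. Equality forces every other t to be -r, and trace zero then gives n = 2.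

Upper bound: f lies below an affine function whose slope term vanishes because ∑ t = 0
(`sqrt_totalRoot_le`); a numerical comparison using n ≥ r+1 finishes and supplies strictness. -/

open Matrix Polynomial

/-! ### Square-root sums of polynomial roots -/

/-- The sum of the square roots of the roots of a real polynomial, counted with multiplicity. -/
noncomputable def Polynomial.sqrtRootSum (p : ℝ[X]) : ℝ := (p.roots.map Real.sqrt).sum

namespace Polynomial

theorem sqrtRootSum_mul {p q : ℝ[X]} (hp : p ≠ 0) (hq : q ≠ 0) :
    (p * q).sqrtRootSum = p.sqrtRootSum + q.sqrtRootSum := by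
  simp [sqrtRootSum, roots_mul (mul_ne_zero hp hq)]

theorem sqrtRootSum_X_sub_C_pow (a : ℝ) (k : ℕ) :
    ((X - C a) ^ k).sqrtRootSum = k * √a := by
  simp [sqrtRootSum, Multiset.map_nsmul, Multiset.sum_nsmul]

theorem sqrtRootSum_prod {ι : Type*} (s : Finset ι) (p : ι → ℝ[X]) (hp : ∀ i ∈ s, p i ≠ 0) :
    (∏ i ∈ s, p i).sqrtRootSum = ∑ i ∈ s, (p i).sqrtRootSum := by
  classical
  induction s using Finset.induction_on with
  | empty => simp [sqrtRootSum]
  | insert a s ha ih =>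
    rw [Finset.prod_insert ha, Finset.sum_insert ha, sqrtRootSum_mul, ih]
    · exact fun i hi => hp i (Finset.mem_insert_of_mem hi)
    · exact hp a (Finset.mem_insert_self a s)
    · exact Finset.prod_ne_zero_iff.2 fun i hi => hp i (Finset.mem_insert_of_mem hi)

theorem sqrtRootSum_X_sub_C (a : ℝ) : (X - C a).sqrtRootSum = √a := by
  simp [sqrtRootSum]

end Polynomial

/-! ### Singular values and block determinants -/

namespace Matrix

variable {m n : Type*} [Fintype m] [Fintype n] [DecidableEq m] [DecidableEq n]

/-- The two characteristic polynomials differ only by powers of X, and the root 0 contributes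
nothing. -/
theorem sqrtRootSum_charpoly_mul_comm (A : Matrix m n ℝ) (B : Matrix n m ℝ) :
    (A * B).charpoly.sqrtRootSum = (B * A).charpoly.sqrtRootSum := by
  have key (k : ℕ) {p : ℝ[X]} (hp : p.Monic) : (X ^ k * p).sqrtRootSum = p.sqrtRootSum := by
    have h := sqrtRootSum_X_sub_C_pow 0 k
    rw [C_0, sub_zero, Real.sqrt_zero, mul_zero] at h
    rw [sqrtRootSum_mul (pow_ne_zero _ X_ne_zero) hp.ne_zero, h, zero_add]
  rw [← key (Fintype.card n) (charpoly_monic (A * B)), charpoly_mul_comm',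
    key _ (charpoly_monic (B * A))]

theorem sum_singularValues_toEuclideanLin (A : Matrix m n ℝ) :
    ((toEuclideanLin A).singularValues.sum fun _ s => s) = (A * Aᵀ).charpoly.sqrtRootSum := by
  set T := toEuclideanLin A with hT
  have hchar : (T.adjoint ∘ₗ T).charpoly = (Aᵀ * A).charpoly := by
    rw [hT, ← toEuclideanLin_conjTranspose_eq_adjoint, ← toLpLin_mul_same,
      conjTranspose_eq_transpose_of_trivial]
    rw [toLpLin_eq_toLin, Matrix.charpoly_toLin]
  rw [sqrtRootSum_charpoly_mul_comm, ← hchar, sqrtRootSum,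
    T.isSymmetric_adjoint_comp_self.roots_charpoly_eq_eigenvalues rfl, Multiset.map_map]
  rw [LinearMap.singularValues, Finsupp.sum_embDomain, Finsupp.sum_fintype _ _ (by simp)]
  simp [Finsupp.ofSupportFinite_coe, Finset.sum]

theorem IsHermitian.det_quadratic {A : Matrix n n ℝ} (hA : A.IsHermitian) (c y r d : ℝ) :
    (c • (y • 1 - A) - (A + r • 1) * (d • 1 - A)).det =
      ∏ i, (c * (y - hA.eigenvalues i) - (hA.eigenvalues i + r) * (d - hA.eigenvalues i)) := by
  set φ := Unitary.conjStarAlgAut ℝ (Matrix n n ℝ) hA.eigenvectorUnitary with hφ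
  set D : Matrix n n ℝ := diagonal hA.eigenvalues with hD
  have hAD : A = φ D := hA.spectral_theorem
  have hg : c • (y • 1 - A) - (A + r • 1) * (d • 1 - A) =
      φ (c • (y • 1 - D) - (D + r • 1) * (d • 1 - D)) := by
    simp only [map_sub, map_mul, map_add, map_smul, map_one, ← hAD]
  have hdet (M : Matrix n n ℝ) : (φ M).det = M.det := by
    rw [hφ, Unitary.conjStarAlgAut_apply, det_mul_comm, ← mul_assoc]
    simp
  rw [hg, hdet, ← det_diagonal]
  congr 1
  ext i j
  by_cases h : i = j
  · subst h
    simp [hD, smul_one_eq_diagonal, diagonal_sub, diagonal_add, diagonal_mul_diagonal]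
  · simp [hD, smul_one_eq_diagonal, diagonal_sub, diagonal_add, diagonal_mul_diagonal, h]

/-- Elimination of the second block of the characteristic matrix of a total graph. -/
theorem det_fromBlocks_total (A : Matrix m m ℝ) (B : Matrix m n ℝ) (y : ℝ) :
    (fromBlocks (y • 1 - A) (-B) (-Bᵀ) ((y + 2) • 1 - Bᵀ * B)).det * (y + 2) ^ Fintype.card m =
      (y + 2) ^ Fintype.card n *
        ((y + 2) • (y • 1 - A) - (B * Bᵀ) * ((1 + y) • 1 - A)).det := by
  -- The row operation turns the lower right block into the scalar y+2; the column operation, scaled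
  -- by y+2 to avoid division, clears the lower left block.
  have h : fromBlocks 1 0 (-Bᵀ) 1 *
        fromBlocks (y • 1 - A) (-B) (-Bᵀ) ((y + 2) • 1 - Bᵀ * B) *
        fromBlocks ((y + 2) • 1) 0 (Bᵀ * ((1 + y) • 1 - A)) 1 =
      fromBlocks ((y + 2) • (y • 1 - A) - (B * Bᵀ) * ((1 + y) • 1 - A)) (-B) 0
        ((y + 2) • 1) := by
    simp only [fromBlocks_multiply]
    congr 1
    · simp [Matrix.mul_assoc, sub_eq_add_neg]
    · simp
    · simp only [Matrix.mul_smul, Matrix.mul_one, Matrix.mul_sub, Matrix.one_mul, Matrix.neg_mul,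
        Matrix.mul_neg, Matrix.add_mul, Matrix.sub_mul, Matrix.smul_mul, smul_add, smul_sub,
        smul_neg]
      simp only [Matrix.mul_assoc]
      module
    · simp
  have h' := congrArg det h
  rw [det_mul, det_mul, det_fromBlocks_zero₁₂, det_fromBlocks_zero₁₂, det_fromBlocks_zero₂₁,
    det_smul, det_smul] at h'
  simp only [det_one, mul_one, one_mul] at h'
  rw [h']
  ring

end Matrix

/-! ### Incidence matrices and the total graph -/

namespace SimpleGraph

variable {V : Type*}

open Classical in
theorem edgeIncMatrix_apply (G : SimpleGraph V) (v : V) (e : G.edgeSet) :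
    G.edgeIncMatrix v e = if v ∈ (e : Sym2 V) then 1 else 0 := by
  simp [edgeIncMatrix, incMatrix_apply', incidenceSet]

open Classical in
theorem edgeIncMatrix_mul_transpose [Fintype V] (G : SimpleGraph V) :
    G.edgeIncMatrix * G.edgeIncMatrixᵀ =
      diagonal (fun v => (G.degree v : ℝ)) + G.adjMatrix ℝ := by
  have h : G.edgeIncMatrix * G.edgeIncMatrixᵀ = G.incMatrix ℝ * (G.incMatrix ℝ)ᵀ := by
    ext u v
    simp only [mul_apply, transpose_apply, edgeIncMatrix, submatrix_apply, id]
    rw [← Finset.sum_subtype G.edgeFinset (by simp)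
      (fun e => G.incMatrix ℝ u e * G.incMatrix ℝ v e)]
    refine Finset.sum_subset (Finset.subset_univ _) fun e _ he => ?_
    rw [G.incMatrix_of_notMem_incidenceSet fun h => he (mem_edgeFinset.2 h.1), zero_mul]
  rw [h, incMatrix_mul_transpose]
  ext u v
  by_cases huv : u = v
  · subst huv; simp
  · simp [huv, adjMatrix_apply]

open Classical in
theorem edgeIncMatrix_transpose_mul [Fintype V] (G : SimpleGraph V) :
    G.edgeIncMatrixᵀ * G.edgeIncMatrix = (2 : ℝ) • 1 + G.lineGraph.adjMatrix ℝ := by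
  ext e f
  simp only [mul_apply, transpose_apply, edgeIncMatrix_apply, Matrix.add_apply, Matrix.smul_apply,
    adjMatrix_apply, one_apply]
  by_cases hef : e = f
  · subst hef
    have h := G.sum_incMatrix_apply_of_mem_edgeSet (R := ℝ) e.2
    simpa [incMatrix_apply', incidenceSet, ← ite_and] using h
  -- Distinct edges share at most one vertex, so the entry is 0 or 1.
  · have hmem : ∀ u v : V, u ∈ (e : Sym2 V) → u ∈ (f : Sym2 V) → v ∈ (e : Sym2 V) →
        v ∈ (f : Sym2 V) → u = v := by
      intro u v hue huf hve hvf
      by_contra huv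
      exact hef (Subtype.ext (((Sym2.mem_and_mem_iff huv).1 ⟨hue, hve⟩).trans
        ((Sym2.mem_and_mem_iff huv).1 ⟨huf, hvf⟩).symm))
    simp only [lineGraph_adj_iff_exists, hef, if_false, smul_eq_mul, mul_zero, zero_add, ne_eq,
      not_false_eq_true, true_and]
    split_ifs with h
    · obtain ⟨v, hve, hvf⟩ := h
      rw [Finset.sum_eq_single v]
      · simp [hve, hvf]
      · intro u _ huv
        by_cases hue : u ∈ (e : Sym2 V)
        · have : u ∉ (f : Sym2 V) := fun huf => huv (hmem u v hue huf hve hvf)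
          simp [this]
        · simp [hue]
      · simp
    · refine Finset.sum_eq_zero fun u _ => ?_
      by_cases hue : u ∈ (e : Sym2 V)
      · have : u ∉ (f : Sym2 V) := fun huf => h ⟨u, hue, huf⟩
        simp [this]
      · simp [hue]

open Classical in
theorem adjMatrix_totalGraph [Fintype V] (G : SimpleGraph V) :
    G.totalGraph.adjMatrix ℝ = fromBlocks (G.adjMatrix ℝ) G.edgeIncMatrix G.edgeIncMatrixᵀ
      (G.edgeIncMatrixᵀ * G.edgeIncMatrix - (2 : ℝ) • 1) := by
  rw [edgeIncMatrix_transpose_mul, add_sub_cancel_left]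
  ext (u | e) (v | f) <;>
    simp only [adjMatrix_apply, fromBlocks_apply₁₁, fromBlocks_apply₁₂, fromBlocks_apply₂₁,
      fromBlocks_apply₂₂, transpose_apply, edgeIncMatrix_apply] <;>
    exact if_congr Iff.rfl rfl rfl

open Classical in
theorem edgeIncMatrix_transpose_mulVec_one [Fintype V] (G : SimpleGraph V) :
    G.edgeIncMatrixᵀ *ᵥ 1 = fun _ => 2 := by
  ext e
  simpa [mulVec, dotProduct, edgeIncMatrix] using
    G.sum_incMatrix_apply_of_mem_edgeSet (R := ℝ) e.2

open Classical in
theorem edgeIncMatrix_mulVec_one [Fintype V] (G : SimpleGraph V) :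
    G.edgeIncMatrix *ᵥ 1 = fun v => (G.degree v : ℝ) := by
  -- Evaluating B Bᵀ 1 both as 2 B 1 and as (D + A) 1 = 2 deg gives the row sums.
  have h2 : G.edgeIncMatrix *ᵥ (G.edgeIncMatrixᵀ *ᵥ 1) = (2 : ℝ) • (G.edgeIncMatrix *ᵥ 1) := by
    rw [edgeIncMatrix_transpose_mulVec_one, ← mulVec_smul]
    congr 1
    ext; simp
  rw [mulVec_mulVec, edgeIncMatrix_mul_transpose] at h2
  ext v
  have := congrFun h2 v
  simp [add_mulVec, adjMatrix_mulVec_apply, mulVec_diagonal] at this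
  linarith

open Classical in
theorem IsRegularOfDegree.totalGraph [Fintype V] {G : SimpleGraph V} {r : ℕ}
    (hG : G.IsRegularOfDegree r) : G.totalGraph.IsRegularOfDegree (2 * r) := by
  intro x
  have h : ((G.totalGraph.adjMatrix ℝ) *ᵥ 1) x = 2 * r := by
    rw [adjMatrix_totalGraph, ← Sum.elim_one_one, fromBlocks_mulVec]
    have hB : G.edgeIncMatrix *ᵥ 1 = (r : ℝ) • 1 := by
      rw [edgeIncMatrix_mulVec_one]
      ext v
      simp [hG.degree_eq v]
    have hBt : G.edgeIncMatrixᵀ *ᵥ 1 = (2 : ℝ) • 1 := by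
      rw [edgeIncMatrix_transpose_mulVec_one]
      ext; simp
    rcases x with v | e
    · simp [hB, adjMatrix_mulVec_apply, hG.degree_eq v]
      ring
    · simp [hB, hBt, sub_mulVec, ← mulVec_mulVec, mulVec_smul, smul_mulVec]
      ring
  rw [adjMatrix_mulVec_apply] at h
  simp at h
  exact_mod_cast h

open Classical in
theorem incidenceEnergy_eq_sqrtRootSum_edgeIncMatrix [Fintype V] (G : SimpleGraph V) :
    G.incidenceEnergy = (G.edgeIncMatrix * G.edgeIncMatrixᵀ).charpoly.sqrtRootSum :=
  sum_singularValues_toEuclideanLin _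

theorem incidenceEnergy_eq_sqrtRootSum [Fintype V] [DecidableEq V] (G : SimpleGraph V)
    [DecidableRel G.Adj] : G.incidenceEnergy =
      (diagonal (fun v => (G.degree v : ℝ)) + G.adjMatrix ℝ).charpoly.sqrtRootSum := by
  rw [incidenceEnergy_eq_sqrtRootSum_edgeIncMatrix, edgeIncMatrix_mul_transpose]
  congr!

end SimpleGraph

/-! ### Real inequalities for the two roots -/

namespace SimpleGraph

/-- The larger of the two signless Laplacian eigenvalues of the total graph of an `r`-regular
graph that come from the adjacency eigenvalue `t`. -/
noncomputable def totalRootPos (r t : ℝ) : ℝ := (2 * t + 5 * r - 2 + √(4 * t + r ^ 2 + 4)) / 2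

/-- The smaller of the two signless Laplacian eigenvalues of the total graph of an `r`-regular
graph that come from the adjacency eigenvalue `t`. -/
noncomputable def totalRootNeg (r t : ℝ) : ℝ := (2 * t + 5 * r - 2 - √(4 * t + r ^ 2 + 4)) / 2

theorem totalRootPos_add_totalRootNeg (r t : ℝ) :
    totalRootPos r t + totalRootNeg r t = 2 * t + 5 * r - 2 := by
  unfold totalRootPos totalRootNeg; ring

theorem totalRootPos_mul_totalRootNeg {r t : ℝ} (ht : -r ≤ t) :
    totalRootPos r t * totalRootNeg r t = t ^ 2 + (5 * r - 3) * t + 6 * r ^ 2 - 5 * r := by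
  have h : √(4 * t + r ^ 2 + 4) ^ 2 = 4 * t + r ^ 2 + 4 :=
    Real.sq_sqrt (by nlinarith [sq_nonneg (r - 2)])
  unfold totalRootPos totalRootNeg
  linear_combination (-1 / 4) * h

theorem totalRootPos_nonneg {r t : ℝ} (hr : 1 ≤ r) (ht : -r ≤ t) : 0 ≤ totalRootPos r t := by
  have := Real.sqrt_nonneg (4 * t + r ^ 2 + 4)
  unfold totalRootPos; linarith

theorem le_totalRootPos_mul_totalRootNeg {r t : ℝ} (hr : 1 ≤ r) (ht : -r ≤ t) :
    r * (2 * r - 2) ≤ totalRootPos r t * totalRootNeg r t := by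
  rw [totalRootPos_mul_totalRootNeg ht]
  -- The difference of the two sides is (t + r)(t + 4r - 3).
  nlinarith [mul_nonneg (by linarith : 0 ≤ t + r) (by linarith : 0 ≤ t + 4 * r - 3)]

theorem totalRootNeg_nonneg {r t : ℝ} (hr : 1 ≤ r) (ht : -r ≤ t) : 0 ≤ totalRootNeg r t := by
  have h : 0 < totalRootPos r t := by
    have := Real.sqrt_nonneg (4 * t + r ^ 2 + 4)
    unfold totalRootPos; linarith
  have := le_totalRootPos_mul_totalRootNeg hr ht
  exact nonneg_of_mul_nonneg_right (this.trans' (by nlinarith)) h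

theorem sq_sqrt_add_sqrt {a b : ℝ} (ha : 0 ≤ a) (hb : 0 ≤ b) :
    (√a + √b) ^ 2 = a + b + 2 * √(a * b) := by
  rw [Real.sqrt_mul ha]
  linear_combination Real.sq_sqrt ha + Real.sq_sqrt hb

/-- After squaring, only the sum and product of the roots matter: the sum is strictly increasing in
t, and the product is least at t = -r. -/
theorem sqrt_totalRoot_lt {r t : ℝ} (hr : 1 ≤ r) (ht : -r < t) :
    √r + √(2 * r - 2) < √(totalRootPos r t) + √(totalRootNeg r t) := by
  refine lt_of_pow_lt_pow_left₀ 2 (by positivity) ?_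
  rw [sq_sqrt_add_sqrt (by linarith) (by linarith),
    sq_sqrt_add_sqrt (totalRootPos_nonneg hr ht.le) (totalRootNeg_nonneg hr ht.le),
    totalRootPos_add_totalRootNeg]
  have := Real.sqrt_le_sqrt (le_totalRootPos_mul_totalRootNeg hr ht.le)
  linarith

/-- At t = -r the roots are r and 2r-2, in an order depending on r; squaring avoids the case split.
-/
theorem sqrt_totalRoot_neg {r : ℝ} (hr : 1 ≤ r) :
    √(totalRootPos r (-r)) + √(totalRootNeg r (-r)) = √r + √(2 * r - 2) := by
  refine (pow_left_inj₀ (by positivity) (by positivity) two_ne_zero).1 ?_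
  rw [sq_sqrt_add_sqrt (totalRootPos_nonneg hr le_rfl) (totalRootNeg_nonneg hr le_rfl),
    sq_sqrt_add_sqrt (by linarith) (by linarith), totalRootPos_add_totalRootNeg, totalRootPos_mul_totalRootNeg le_rfl]
  ring_nf

theorem sqrt_totalRoot_self {r : ℝ} (hr : 1 ≤ r) :
    √(totalRootPos r r) + √(totalRootNeg r r) = 2 * √r + √(3 * r - 2) := by
  have h : √(4 * r + r ^ 2 + 4) = r + 2 := by
    rw [show 4 * r + r ^ 2 + 4 = (r + 2) ^ 2 by ring, Real.sqrt_sq (by linarith)]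
  have h4 : √(2 ^ 2 * r) = 2 * √r := by
    rw [Real.sqrt_mul (by positivity), Real.sqrt_sq (by norm_num)]
  rw [← h4]
  unfold totalRootPos totalRootNeg
  rw [h]
  ring_nf

theorem sqrt_totalRoot_le {r t : ℝ} (hr : 1 ≤ r) (ht : -r ≤ t) :
    √(totalRootPos r t) + √(totalRootNeg r t) ≤ √(10 * r - 4) + 2 / √(10 * r - 4) * t := by
  set s := √(10 * r - 4) with hs
  have hs0 : 0 < s := Real.sqrt_pos.2 (by linarith)
  have hs2 : s ^ 2 = 10 * r - 4 := Real.sq_sqrt (by linarith)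
  have ha := Real.sq_sqrt (totalRootPos_nonneg hr ht)
  have hb := Real.sq_sqrt (totalRootNeg_nonneg hr ht)
  have hsum := totalRootPos_add_totalRootNeg r t
  set a := √(totalRootPos r t)
  set b := √(totalRootNeg r t)
  -- With (a+b)² ≤ 2(a²+b²) = s² + 4t, this follows from 2(a+b)s ≤ (a+b)² + s².
  have key : (a + b) * s ≤ s ^ 2 + 2 * t := by
    nlinarith [sq_nonneg (a + b - s), sq_nonneg (a - b)]
  have : s + 2 / s * t = (s ^ 2 + 2 * t) / s := by field_simp
  rwa [this, le_div_iff₀ hs0]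

theorem sqrt_lt_two_mul_sqrt_add {r n : ℕ} (hr : 1 ≤ r) (hn : r + 1 ≤ n) :
    (n : ℝ) * √(10 * r - 4) < 2 * n * √r + (n - 1) * √(3 * r - 2) := by
  have hr' : (1 : ℝ) ≤ r := by exact_mod_cast hr
  have hn' : (r : ℝ) + 1 ≤ n := by exact_mod_cast hn
  have hn0 : (0 : ℝ) < n := by linarith
  obtain ⟨k, hk0, hkn, hk⟩ : ∃ k : ℝ, 0 ≤ k ∧ n * k ≤ n - 1 ∧
      10 * (r : ℝ) - 4 < 4 * r + k ^ 2 * (3 * r - 2) + 4 * k * (1.7 * r - 0.7) := by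
    rcases hr.eq_or_lt with rfl | hr2
    · exact ⟨1 / 2, by norm_num, by push_cast at hn'; linarith, by norm_num⟩
    · have hr2' : (2 : ℝ) ≤ r := by exact_mod_cast hr2
      rcases Nat.lt_or_ge r 3 with h3 | h3
      · have h3' : (r : ℝ) = 2 := by
          have : r = 2 := by omega
          rw [this]; norm_num
        exact ⟨2 / 3, by norm_num, by linarith, by rw [h3']; norm_num⟩
      · have h3' : (3 : ℝ) ≤ r := by exact_mod_cast h3
        exact ⟨3 / 4, by norm_num, by linarith, by linarith⟩
  have hs : 1.7 * (r : ℝ) - 0.7 ≤ √(r * (3 * r - 2)) :=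
    Real.le_sqrt_of_sq_le (by nlinarith)
  have h : √(10 * r - 4) < 2 * √r + k * √(3 * r - 2) := by
    rw [Real.sqrt_lt' (by positivity)]
    rw [Real.sqrt_mul (by linarith)] at hs
    have h1 := Real.sq_sqrt (show (0 : ℝ) ≤ r by linarith)
    have h2 := Real.sq_sqrt (show (0 : ℝ) ≤ 3 * r - 2 by linarith)
    calc 10 * (r : ℝ) - 4 < 4 * r + k ^ 2 * (3 * r - 2) + 4 * k * (1.7 * r - 0.7) := hk
      _ ≤ 4 * r + k ^ 2 * (3 * r - 2) + 4 * k * (√r * √(3 * r - 2)) := by gcongr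
      _ = _ := by linear_combination (-4) * h1 - k ^ 2 * h2
  calc (n : ℝ) * √(10 * r - 4) < n * (2 * √r + k * √(3 * r - 2)) := by gcongr
    _ = 2 * n * √r + n * k * √(3 * r - 2) := by ring
    _ ≤ _ := by gcongr

end SimpleGraph

/-! ### Spectra of a regular graph and its total graph -/

namespace SimpleGraph

variable {V : Type*} {G : SimpleGraph V} {r : ℕ}

open Classical in
theorem isHermitian_adjMatrix_real (G : SimpleGraph V) : (G.adjMatrix ℝ).IsHermitian := by
  rw [IsHermitian, conjTranspose_eq_transpose_of_trivial, transpose_adjMatrix]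

variable [Fintype V]

open Classical in
/-- The adjacency eigenvalues of a finite graph. -/
noncomputable def adjEigenvalues (G : SimpleGraph V) : V → ℝ :=
  G.isHermitian_adjMatrix_real.eigenvalues

open Classical in
theorem sum_adjEigenvalues (G : SimpleGraph V) : ∑ i, G.adjEigenvalues i = 0 := by
  have h := G.isHermitian_adjMatrix_real.trace_eq_sum_eigenvalues
  rw [trace_adjMatrix] at h
  exact h.symm

open Classical in
theorem IsRegularOfDegree.edgeIncMatrix_mul_transpose (hG : G.IsRegularOfDegree r) :
    G.edgeIncMatrix * G.edgeIncMatrixᵀ = G.adjMatrix ℝ + (r : ℝ) • 1 := by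
  rw [SimpleGraph.edgeIncMatrix_mul_transpose, add_comm, smul_one_eq_diagonal]
  simp only [hG.degree_eq]

open Classical in
theorem IsRegularOfDegree.neg_le_adjEigenvalues (hG : G.IsRegularOfDegree r) (i : V) :
    -(r : ℝ) ≤ G.adjEigenvalues i := by
  set v : V → ℝ := ⇑(G.isHermitian_adjMatrix_real.eigenvectorBasis i) with hv
  have hAv : G.adjMatrix ℝ *ᵥ v = G.adjEigenvalues i • v :=
    G.isHermitian_adjMatrix_real.mulVec_eigenvectorBasis i
  have hvv : 0 < v ⬝ᵥ v := by
    have hne : v ≠ 0 := fun h =>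
      G.isHermitian_adjMatrix_real.eigenvectorBasis.toBasis.ne_zero i (by
        rw [OrthonormalBasis.coe_toBasis]
        ext j
        exact congrFun h j)
    simpa using dotProduct_star_self_pos_iff.2 hne
  -- A + r = B Bᵀ is positive semidefinite.
  have h0 : 0 ≤ v ⬝ᵥ ((G.edgeIncMatrix * G.edgeIncMatrixᵀ) *ᵥ v) := by
    rw [← mulVec_mulVec, dotProduct_mulVec, ← mulVec_transpose]
    exact Finset.sum_nonneg fun _ _ => mul_self_nonneg _
  rw [hG.edgeIncMatrix_mul_transpose, add_mulVec, hAv, smul_mulVec, one_mulVec, ← add_smul,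
    dotProduct_smul, smul_eq_mul] at h0
  have := nonneg_of_mul_nonneg_left h0 hvv
  linarith

open Classical in
theorem IsRegularOfDegree.exists_adjEigenvalues_eq [Nonempty V] (hG : G.IsRegularOfDegree r) :
    ∃ i, G.adjEigenvalues i = r := by
  have h : (r : ℝ) ∈ spectrum ℝ (G.adjMatrix ℝ) := by
    rw [← spectrum_toLin']
    refine Module.End.HasEigenvalue.mem_spectrum
      (Module.End.hasEigenvalue_of_hasEigenvector (x := (1 : V → ℝ)) ?_)
    refine ⟨Module.End.mem_eigenspace_iff.2 ?_, one_ne_zero⟩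
    ext v
    simp [toLin'_apply, adjMatrix_mulVec_apply, hG.degree_eq v]
  rw [G.isHermitian_adjMatrix_real.spectrum_real_eq_range_eigenvalues] at h
  exact h

-- Powers stay on both sides because m - n is negative when r = 1.
open Classical in
theorem IsRegularOfDegree.charpoly_totalGraph (hG : G.IsRegularOfDegree r) :
    (diagonal (fun x => (G.totalGraph.degree x : ℝ)) + G.totalGraph.adjMatrix ℝ).charpoly *
        (X - C (2 * (r : ℝ) - 2)) ^ Fintype.card V =
      (X - C (2 * (r : ℝ) - 2)) ^ Fintype.card G.edgeSet *
        ∏ i, ((X - C (totalRootPos r (G.adjEigenvalues i))) *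
          (X - C (totalRootNeg r (G.adjEigenvalues i)))) := by
  refine Polynomial.funext fun x => ?_
  have hM : scalar _ x -
        (diagonal (fun x => (G.totalGraph.degree x : ℝ)) + G.totalGraph.adjMatrix ℝ) =
      fromBlocks ((x - 2 * r) • 1 - G.adjMatrix ℝ) (-G.edgeIncMatrix) (-G.edgeIncMatrixᵀ)
        ((x - 2 * r + 2) • 1 - G.edgeIncMatrixᵀ * G.edgeIncMatrix) := by
    simp only [hG.totalGraph.degree_eq]
    rw [sub_eq_iff_eq_add, adjMatrix_totalGraph, ← smul_one_eq_diagonal, scalar_apply,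
      ← smul_one_eq_diagonal, ← fromBlocks_one, fromBlocks_smul, fromBlocks_smul, fromBlocks_add,
      fromBlocks_add]
    push_cast
    congr 1
    · module
    · simp
    · simp
    · module
  have hdet := det_fromBlocks_total (G.adjMatrix ℝ) G.edgeIncMatrix (x - 2 * r)
  rw [← hM, hG.edgeIncMatrix_mul_transpose,
    G.isHermitian_adjMatrix_real.det_quadratic] at hdet
  simp only [eval_mul, eval_pow, eval_sub, eval_X, eval_C, eval_prod, eval_charpoly]
  rw [show x - (2 * (r : ℝ) - 2) = x - 2 * r + 2 by ring, hdet]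
  congr 1
  refine Finset.prod_congr rfl fun i _ => ?_
  have h1 := totalRootPos_add_totalRootNeg r (G.adjEigenvalues i)
  have h2 := totalRootPos_mul_totalRootNeg (hG.neg_le_adjEigenvalues i)
  change _ * (_ - G.adjEigenvalues i) - (G.adjEigenvalues i + _) * (_ - G.adjEigenvalues i) = _
  linear_combination x * h1 - h2

open Classical in
theorem IsRegularOfDegree.incidenceEnergy_totalGraph (hG : G.IsRegularOfDegree r) :
    G.totalGraph.incidenceEnergy =
      (Fintype.card V : ℝ) * ((r : ℝ) - 2) * √(2 * (r : ℝ) - 2) / 2 +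
        ∑ i, (√(totalRootPos r (G.adjEigenvalues i)) +
          √(totalRootNeg r (G.adjEigenvalues i))) := by
  have h := congrArg sqrtRootSum hG.charpoly_totalGraph
  have hX (a : ℝ) : (X - C a : ℝ[X]) ≠ 0 := X_sub_C_ne_zero a
  rw [sqrtRootSum_mul (charpoly_monic _).ne_zero (pow_ne_zero _ (hX _)),
    sqrtRootSum_mul (pow_ne_zero _ (hX _))
      (Finset.prod_ne_zero_iff.2 fun i _ => mul_ne_zero (hX _) (hX _)),
    sqrtRootSum_prod _ _ fun i _ => mul_ne_zero (hX _) (hX _),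
    sqrtRootSum_X_sub_C_pow, sqrtRootSum_X_sub_C_pow, ← incidenceEnergy_eq_sqrtRootSum] at h
  simp only [sqrtRootSum_mul (hX _) (hX _), sqrtRootSum_X_sub_C] at h
  have hcard : (Fintype.card V : ℝ) * r = 2 * Fintype.card G.edgeSet := by
    have := G.sum_degrees_eq_twice_card_edges
    simp only [hG.degree_eq, Finset.sum_const, smul_eq_mul, Finset.card_univ,
      edgeFinset_card] at this
    exact_mod_cast this
  linear_combination h - √(2 * (r : ℝ) - 2) / 2 * hcard

theorem nonempty_iso_top_iff_card_eq_two [DecidableRel G.Adj] (hr : 1 ≤ r)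
    (hG : G.IsRegularOfDegree r) :
    Nonempty (G ≃g (⊤ : SimpleGraph (Fin 2))) ↔ Fintype.card V = 2 := by
  refine ⟨fun ⟨f⟩ => by simpa using Fintype.card_congr f.toEquiv, fun h => ?_⟩
  have htop : G = ⊤ := by
    ext u v
    refine ⟨fun huv => huv.ne, fun huv => ?_⟩
    obtain ⟨w, hw⟩ := (G.degree_pos_iff_exists_adj u).1 (by rw [hG.degree_eq]; exact hr)
    by_contra hv
    have hwv : w ≠ v := fun e => hv (e ▸ hw)
    classical
    have := Finset.card_le_univ {u, v, w}
    rw [Finset.card_eq_three.2 ⟨u, v, w, huv, hw.ne, hwv.symm, rfl⟩, h] at this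
    omega
  subst htop
  exact ⟨Iso.completeGraph (Fintype.equivFinOfCardEq h)⟩

end SimpleGraph

/-! ### The two bounds and the equality case -/

open SimpleGraph in
theorem theorem3p2 {V : Type*} [Fintype V] [DecidableEq V] [Nonempty V]
    (G : SimpleGraph V) [DecidableRel G.Adj] (n r : ℕ) (hn : Fintype.card V = n)
    (hr : 1 ≤ r) (hG : G.IsRegularOfDegree r) :
    G.totalGraph.incidenceEnergy <
        (n : ℝ) * ((r : ℝ) - 2) * √(2 * (r : ℝ) - 2) / 2 + 2 * (n : ℝ) * √(r : ℝ)
          + ((n : ℝ) - 1) * √(3 * (r : ℝ) - 2) ∧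
      (n : ℝ) * ((r : ℝ) - 2) * √(2 * (r : ℝ) - 2) / 2 + ((n : ℝ) + 1) * √(r : ℝ)
          + √(3 * (r : ℝ) - 2) + ((n : ℝ) - 1) * √(2 * (r : ℝ) - 2)
        ≤ G.totalGraph.incidenceEnergy ∧
      (G.totalGraph.incidenceEnergy =
          (n : ℝ) * ((r : ℝ) - 2) * √(2 * (r : ℝ) - 2) / 2 + ((n : ℝ) + 1) * √(r : ℝ)
            + √(3 * (r : ℝ) - 2) + ((n : ℝ) - 1) * √(2 * (r : ℝ) - 2) ↔
        Nonempty (G ≃g (⊤ : SimpleGraph (Fin 2)))) := by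
  have hr' : (1 : ℝ) ≤ r := by exact_mod_cast hr
  have hE := IsRegularOfDegree.incidenceEnergy_totalGraph (G := G) (r := r) fun v => by convert! hG v
  have hrn : r + 1 ≤ n := by
    obtain ⟨v⟩ := ‹Nonempty V›
    have := G.degree_lt_card_verts v
    rw [hG.degree_eq, hn] at this
    omega
  have hE' : G.totalGraph.incidenceEnergy = _ := Eq.trans (by congr!) hE
  rw [hE', hn, nonempty_iso_top_iff_card_eq_two hr hG, hn]
  set b := (n : ℝ) * ((r : ℝ) - 2) * √(2 * (r : ℝ) - 2) / 2
  set t := G.adjEigenvalues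
  set f : ℝ → ℝ := fun x => √(totalRootPos r x) + √(totalRootNeg r x)
  have hsum : ∑ i, t i = 0 := G.sum_adjEigenvalues
  have hge (i : V) : -(r : ℝ) ≤ t i := IsRegularOfDegree.neg_le_adjEigenvalues (fun v => by convert! hG v) i
  obtain ⟨i₀, hi₀⟩ : ∃ i, t i = r :=
    IsRegularOfDegree.exists_adjEigenvalues_eq fun v => by convert! hG v
  set s := Finset.univ.erase i₀
  have hcard : (s.card : ℝ) = n - 1 := by
    rw [Finset.card_erase_of_mem (Finset.mem_univ _), Finset.card_univ, hn,
      Nat.cast_sub (by omega), Nat.cast_one]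
  have hsplit : ∑ i, f (t i) = 2 * √r + √(3 * r - 2) + ∑ i ∈ s, f (t i) := by
    rw [← Finset.add_sum_erase _ _ (Finset.mem_univ i₀), hi₀]
    exact congrArg (· + _) (sqrt_totalRoot_self hr')
  have hfle (i : V) : f (-r) ≤ f (t i) := by
    rcases (hge i).eq_or_lt with h | h
    · rw [← h]
    · exact (sqrt_totalRoot_neg hr').trans_le (sqrt_totalRoot_lt hr' h).le
  have hconst : ∑ _i ∈ s, f (-r) = (n - 1) * (√r + √(2 * r - 2)) := by
    rw [Finset.sum_const, nsmul_eq_mul, hcard]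
    exact congrArg _ (sqrt_totalRoot_neg hr')
  -- Trace zero makes the remaining n-1 eigenvalues sum to -r.
  have hshift : ∑ i ∈ s, (t i + r) = (n - 2) * r := by
    rw [Finset.sum_add_distrib, Finset.sum_const, nsmul_eq_mul, hcard]
    rw [← Finset.add_sum_erase _ _ (Finset.mem_univ i₀), hi₀] at hsum
    linear_combination hsum
  have hle : ∑ _i ∈ s, f (-r) ≤ ∑ i ∈ s, f (t i) := Finset.sum_le_sum fun i _ => hfle i
  have heq : ∑ _i ∈ s, f (-r) = ∑ i ∈ s, f (t i) ↔ n = 2 := by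
    calc ∑ _i ∈ s, f (-r) = ∑ i ∈ s, f (t i) ↔ ∀ i ∈ s, f (-r) = f (t i) :=
          Finset.sum_eq_sum_iff_of_le fun i _ => hfle i
      _ ↔ ∀ i ∈ s, t i + r = 0 := by
          refine forall₂_congr fun i _ => ⟨fun h => ?_, fun h => ?_⟩
          · by_contra hne
            have hlt : -(r : ℝ) < t i := lt_of_le_of_ne (hge i) fun e => hne (by linarith)
            exact absurd h
              ((sqrt_totalRoot_neg hr').trans_lt (sqrt_totalRoot_lt hr' hlt)).ne
          · rw [eq_neg_of_add_eq_zero_left h]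
      _ ↔ ∑ i ∈ s, (t i + r) = 0 :=
          (Finset.sum_eq_zero_iff_of_nonneg fun i _ => by linarith [hge i]).symm
      _ ↔ n = 2 := by
          rw [hshift, mul_eq_zero, or_iff_left (by linarith), sub_eq_zero]
          norm_cast
  refine ⟨?_, ?_, ?_⟩
  · have hub : ∑ i, f (t i) ≤ n * √(10 * r - 4) := by
      calc ∑ i, f (t i) ≤ ∑ i, (√(10 * r - 4) + 2 / √(10 * r - 4) * t i) :=
            Finset.sum_le_sum fun i _ => sqrt_totalRoot_le hr' (hge i)
        _ = n * √(10 * r - 4) := by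
            rw [Finset.sum_add_distrib, ← Finset.mul_sum, hsum, Finset.sum_const,
              Finset.card_univ, hn, nsmul_eq_mul, mul_zero, add_zero]
    have := sqrt_lt_two_mul_sqrt_add hr hrn
    linarith
  · rw [hsplit]
    linarith
  · rw [← heq, hsplit]
    constructor <;> intro h <;> linarith
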